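/- Let $H=\{1,\dots,n\}$ be partitioned into $\delta$ nonempty blocks $\Pi=(\Pi_1,\dots,\Pi_\delta)$. A \emph{vertex} is a set $J\subseteq H$ with $|J\cap\Pi_i|=1$ for all $i$. The ($\delta$-dimensional) \emph{grid} $\mathcal G$ is the graph on all vertices in which $J,J'$ are adjacent if and only if $|J\oplus J'|=2$, where $\oplus$ denotes symmetric difference; for $G\subseteq H$, the \emph{subgrid} spanned by $G$ is the subgraph of $\mathcal G$ induced on the vertices $J\subseteq G$. A \emph{unique sink orientation} (USO) is an orientation $\psi$ of the edges of $\mathcal G$ such that every nonempty subgrid has a unique sink (a vertex without outgoing edges in the subgrid). An \emph{edge evaluation} returns the orientation of one edge of $\mathcal G$, chosen by the algorithm. \textbf{Theorem.} The sink of a unique sink orientation of a $\delta$-dimensional grid on $n$ elements can be found by evaluating an expected number of $O\left(\delta n+\delta^{O(\delta)}\right)$ edges. That is, there are absolute constants $C,c$ such that for all $n,\delta$ and every partition $\Pi$ of $\{1,\dots,n\}$ into $\delta$ nonempty blocks there is a randomized algorithm which accesses the orientation only through (adaptively chosen) edge evaluations and which, on every unique sink orientation $\psi$ of the grid, always returns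 the sink of $\psi$ and performs in expectation (over its own random choices) at most $C\left(\delta n+\delta^{c\delta}\right)$ edge evaluations. (Here $0^0=1$.) -/

import Mathlib

/-- An ordered partition `(Π₁, …, Π_δ)` of the `n`-element set `H = Fin n` into `δ` nonempty
blocks, given by the map that sends each element to the index of its block. The blocks are
nonempty because this map is surjective. -/
structure GridPartition (n δ : ℕ) where
  blockOf : Fin n → Fin δ
  surjective : Function.Surjective blockOf

namespace GridPartition

variable {n δ : ℕ} (P : GridPartition n δ)

/-- The block `Π_i`. -/
def block (i : Fin δ) : Finset (Fin n) := Finset.univ.filter fun h => P.blockOf h = i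

/-- `J ⊆ H` is a vertex if it contains exactly one element of each block. -/
def IsVertex (J : Finset (Fin n)) : Prop := ∀ i : Fin δ, (J ∩ P.block i).card = 1

/-- The set of all vertices. -/
abbrev Vertex : Type := {J : Finset (Fin n) // P.IsVertex J}

/-- The `δ`-dimensional grid spanned by `H`: two vertices are adjacent if their symmetric
difference has exactly two elements. -/
def grid : SimpleGraph P.Vertex where
  Adj J J' := (symmDiff J.1 J'.1).card = 2
  symm := ⟨fun J J' h => by rwa [symmDiff_comm]⟩
  loopless := ⟨fun J h => by simp at h⟩

/-- The vertices `J ⊆ G` of the subgrid spanned by `G ⊆ H`. The subgrid is the subgraph of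
`P.grid` induced on this set. -/
def subgridVertices (G : Finset (Fin n)) : Set P.Vertex := {J | J.1 ⊆ G}

end GridPartition

/-- An orientation of a simple graph: `arrow u v` means that `{u, v}` is an edge which is
directed from `u` to `v`; every edge has exactly one of its two directions. -/
structure GraphOrientation {V : Type} (Γ : SimpleGraph V) where
  arrow : V → V → Prop
  adj_of_arrow : ∀ u v, arrow u v → Γ.Adj u v
  xor_of_adj : ∀ u v, Γ.Adj u v → Xor (arrow u v) (arrow v u)

namespace GraphOrientation

variable {V : Type} {Γ : SimpleGraph V} (ψ : GraphOrientation Γ)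

/-- `v` is a sink of the subgraph of `Γ` induced on `S`: it lies in `S`, and no edge of this
subgraph leaves `v`. -/
def IsSinkOf (S : Set V) (v : V) : Prop := v ∈ S ∧ ∀ u ∈ S, ¬ ψ.arrow v u

/-- `v` is a sink of the whole graph `Γ`. -/
def IsSink (v : V) : Prop := ψ.IsSinkOf Set.univ v

open Classical in
/-- The result of evaluating the edge `{u, v}`, presented as the ordered pair `e = (u, v)`:
`true` if the edge is directed from `u` to `v`, and `false` if it is directed from `v` to `u`. -/
noncomputable def evalEdge (e : Γ.Dart) : Bool := decide (ψ.arrow e.fst e.snd)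

end GraphOrientation

/-- Unique sink orientation of a grid: every nonempty subgrid has a unique sink. -/
def IsUSO {n δ : ℕ} {P : GridPartition n δ} (ψ : GraphOrientation P.grid) : Prop :=
  ∀ G : Finset (Fin n), (P.subgridVertices G).Nonempty →
    ∃! J : P.Vertex, ψ.IsSinkOf (P.subgridVertices G) J

/-- A randomized algorithm that accesses an unknown orientation of the graph `Γ` only through
edge evaluations, and returns a vertex. At each point it either stops with an output, evaluates
an edge and continues depending on the answer, or picks one of `m + 1` continuations uniformly
at random. -/
inductive EdgeAlgorithm {V : Type} (Γ : SimpleGraph V) : Type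
  | output (v : V) : EdgeAlgorithm Γ
  | evaluate (e : Γ.Dart) (next : Bool → EdgeAlgorithm Γ) : EdgeAlgorithm Γ
  | random (m : ℕ) (next : Fin (m + 1) → EdgeAlgorithm Γ) : EdgeAlgorithm Γ

namespace EdgeAlgorithm

variable {V : Type} {Γ : SimpleGraph V}

/-- For all outcomes of its random choices, the algorithm, run on `ψ`, returns a sink of `ψ`. -/
def FindsSink (ψ : GraphOrientation Γ) : EdgeAlgorithm Γ → Prop
  | output v => ψ.IsSink v
  | evaluate e next => FindsSink ψ (next (ψ.evalEdge e))
  | random _ next => ∀ i, FindsSink ψ (next i)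

/-- The expected number of edge evaluations that the algorithm performs when run on `ψ`. -/
noncomputable def expectedEvaluations (ψ : GraphOrientation Γ) : EdgeAlgorithm Γ → ℝ
  | output _ => 0
  | evaluate e next => 1 + expectedEvaluations ψ (next (ψ.evalEdge e))
  | random m next => (∑ i, expectedEvaluations ψ (next i)) / ((m : ℝ) + 1)

end EdgeAlgorithm

/-!
The sink of a subgrid behaves like the basis of a linear program. Say that `h` violates a
vertex `J` if the edge from `J` to the vertex with `h` exchanged in is
outgoing at `J`; then `J` is the sink of the subgrid spanned
by `S ⊇ J` exactly if no `h ∈ S` violates it. Uniqueness of sinks gives two facts. If the sink of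
`Q ⊆ S` is violated in `S`, then it is violated by one of the `δ` elements of the sink of `S`
(`exists_mem_violators`). And if `R` is a random `r`-element subset of `S`, then the sink of
`G ∪ R` has at most `δ|S| / (r + 1)` violators in `S` on average (`average_card_violators_le`).

These facts carry Clarkson's sampling scheme: keep a set `G`, find recursively the sink of `G ∪ R`
for a random `R`, determine its violators with at most `|S|` edge evaluations, and add them to `G`.
Every round that finds violators puts another element of the sink of `S`
into `G`, so there are at most `δ + 1` rounds.
Rounds with unusually many violators need not be rejected: the cost bound that is proved by
induction, `2Dm + b√m` for `m` elements with `D = δ + 1`, is concave in `m`, so only the expected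
size of the subproblems matters (`expectedEvaluations_samplingRounds_le`). With `r` about `D√m`
this size is at most `4D√m`.

Algorithms are finite trees, so the recursion is cut off at some depth, where, as for subgrids with
fewer than `256D⁶` elements, all vertices are tried. This costs at most `m ^ D` evaluations. As
every level of the recursion halves `b` in the contribution of the cutoff, a large depth makes this
contribution negligible (`expectedEvaluations_solve_le`). What remains is `b ≤ (256D⁶) ^ D + 1`,
and `b√n ≤ b² + n` gives the bound `O(δn + δ ^ O(δ))`.
-/

/-! ### Composing algorithms -/

namespace EdgeAlgorithm

variable {V : Type} {Γ : SimpleGraph V}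

/-- For all outcomes of its random choices, the algorithm, run on `ψ`, returns the vertex `v`. -/
def Returns (ψ : GraphOrientation Γ) (v : V) : EdgeAlgorithm Γ → Prop
  | output w => w = v
  | evaluate e next => Returns ψ v (next (ψ.evalEdge e))
  | random _ next => ∀ i, Returns ψ v (next i)

theorem Returns.findsSink {ψ : GraphOrientation Γ} {v : V} (hv : ψ.IsSink v) :
    ∀ {A : EdgeAlgorithm Γ}, A.Returns ψ v → A.FindsSink ψ
  | output w, h => by
      change w = v at h
      subst h
      exact hv
  | evaluate e next, h => Returns.findsSink (A := next (ψ.evalEdge e)) hv h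
  | random _ next, h => fun i => Returns.findsSink (A := next i) hv (h i)

/-- Run an algorithm, and continue with an algorithm that depends on its output. -/
def bind : EdgeAlgorithm Γ → (V → EdgeAlgorithm Γ) → EdgeAlgorithm Γ
  | output v, k => k v
  | evaluate e next, k => evaluate e fun b => bind (next b) k
  | random m next, k => random m fun i => bind (next i) k

theorem Returns.bind {ψ : GraphOrientation Γ} {v w : V} {k : V → EdgeAlgorithm Γ}
    (hk : (k v).Returns ψ w) :
    ∀ {A : EdgeAlgorithm Γ}, A.Returns ψ v → (A.bind k).Returns ψ w
  | output u, h => by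
      change u = v at h
      subst h
      exact hk
  | evaluate e next, h => Returns.bind (A := next (ψ.evalEdge e)) hk h
  | random _ next, h => fun i => Returns.bind (A := next i) hk (h i)

theorem expectedEvaluations_bind {ψ : GraphOrientation Γ} {v : V} (k : V → EdgeAlgorithm Γ) :
    ∀ {A : EdgeAlgorithm Γ}, A.Returns ψ v →
      (A.bind k).expectedEvaluations ψ = A.expectedEvaluations ψ + (k v).expectedEvaluations ψ
  | output u, h => by
      change u = v at h
      subst h
      simp [EdgeAlgorithm.bind, expectedEvaluations]
  | evaluate e next, h => by
      simp only [EdgeAlgorithm.bind, expectedEvaluations]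
      rw [expectedEvaluations_bind k (A := next (ψ.evalEdge e)) h, add_assoc]
  | random m next, h => by
      simp only [EdgeAlgorithm.bind, expectedEvaluations]
      rw [Finset.sum_congr rfl fun i _ => expectedEvaluations_bind k (A := next i) (h i),
        Finset.sum_add_distrib, add_div]
      congr 1
      have : (m : ℝ) + 1 ≠ 0 := by positivity
      simp only [Finset.sum_const, Finset.card_univ, Fintype.card_fin, nsmul_eq_mul]
      push_cast
      field_simp

/-- Draw an element of a nonempty finite set uniformly at random, and continue with an algorithm
that depends on it. -/
noncomputable def sample {α : Type} (s : Finset α) (hs : s.Nonempty) (k : α → EdgeAlgorithm Γ) :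
    EdgeAlgorithm Γ :=
  random (s.card - 1) fun i =>
    k (s.equivFin.symm (Fin.cast (Nat.sub_add_cancel hs.card_pos) i))

theorem returns_sample {ψ : GraphOrientation Γ} {v : V} {α : Type} {s : Finset α}
    (hs : s.Nonempty) {k : α → EdgeAlgorithm Γ} (h : ∀ a ∈ s, (k a).Returns ψ v) :
    (sample s hs k).Returns ψ v :=
  fun _ => h _ (Finset.coe_mem _)

theorem expectedEvaluations_sample (ψ : GraphOrientation Γ) {α : Type} {s : Finset α}
    (hs : s.Nonempty) (k : α → EdgeAlgorithm Γ) :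
    (sample s hs k).expectedEvaluations ψ =
      (∑ a ∈ s, (k a).expectedEvaluations ψ) / (s.card : ℝ) := by
  have hc : s.card - 1 + 1 = s.card := Nat.sub_add_cancel hs.card_pos
  simp only [sample, expectedEvaluations]
  congr 1
  · rw [← Finset.sum_coe_sort s fun a => (k a).expectedEvaluations ψ]
    exact Equiv.sum_comp ((finCongr hc).trans s.equivFin.symm)
      fun a => (k a).expectedEvaluations ψ
  · exact_mod_cast hc

end EdgeAlgorithm

namespace GridPartition

variable {n δ : ℕ} {P : GridPartition n δ}

open EdgeAlgorithm

/-! ### Vertices and exchanges -/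

namespace IsVertex

variable {J : Finset (Fin n)}

theorem exists_mem (hJ : P.IsVertex J) (i : Fin δ) : ∃ x ∈ J, P.blockOf x = i := by
  obtain ⟨x, hx⟩ := Finset.card_eq_one.1 (hJ i)
  have : x ∈ J ∩ P.block i := by simp [hx]
  exact ⟨x, by simpa [block] using this⟩

theorem eq_of_mem (hJ : P.IsVertex J) {x y : Fin n} (hx : x ∈ J) (hy : y ∈ J)
    (h : P.blockOf x = P.blockOf y) : x = y :=
  Finset.card_le_one.1 (hJ (P.blockOf y)).le x (by simp [block, hx, h]) y (by simp [block, hy])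

theorem card_eq (hJ : P.IsVertex J) : J.card = δ := by
  have : J.card = (Finset.univ : Finset (Fin δ)).card :=
    Finset.card_nbij P.blockOf (by simp) (fun x hx y hy h => hJ.eq_of_mem hx hy h)
      fun i _ => by obtain ⟨x, hx, rfl⟩ := hJ.exists_mem i; exact ⟨x, hx, rfl⟩
  simpa using this

end IsVertex

theorem isVertex_of_existsUnique {J : Finset (Fin n)}
    (h : ∀ i, ∃ x, ∀ y, y ∈ J ∧ P.blockOf y = i ↔ y = x) : P.IsVertex J := by
  intro i
  obtain ⟨x, hx⟩ := h i
  refine Finset.card_eq_one.2 ⟨x, ?_⟩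
  ext y
  simpa [block] using hx y

theorem nonempty_vertex (P : GridPartition n δ) : Nonempty P.Vertex := by
  choose f hf using P.surjective
  refine ⟨Finset.univ.image f, isVertex_of_existsUnique fun i => ⟨f i, fun y => ?_⟩⟩
  constructor
  · rintro ⟨hy, rfl⟩
    obtain ⟨j, -, rfl⟩ := Finset.mem_image.1 hy
    rw [hf]
  · rintro rfl
    simp [hf]

/-- The vertex obtained from `J` by exchanging the element in the block of `h` for `h`. -/
def exchange (J : P.Vertex) (h : Fin n) : P.Vertex :=
  ⟨insert h (J.1.filter fun x => P.blockOf x ≠ P.blockOf h), by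
    refine isVertex_of_existsUnique fun i => ?_
    by_cases hi : P.blockOf h = i
    · refine ⟨h, fun y => ?_⟩
      simp only [Finset.mem_insert, Finset.mem_filter]
      grind
    · obtain ⟨x, hx, hxi⟩ := J.2.exists_mem i
      refine ⟨x, fun y => ?_⟩
      have := fun hy hxy => J.2.eq_of_mem (x := y) (y := x) hy hx hxy
      simp only [Finset.mem_insert, Finset.mem_filter]
      grind⟩

theorem mem_exchange {J : P.Vertex} {h y : Fin n} :
    y ∈ (exchange J h).1 ↔ y = h ∨ y ∈ J.1 ∧ P.blockOf y ≠ P.blockOf h := by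
  simp [exchange]

theorem exchange_of_mem {J : P.Vertex} {h : Fin n} (hh : h ∈ J.1) : exchange J h = J := by
  ext y
  have := fun hy hxy => J.2.eq_of_mem (x := y) (y := h) hy hh hxy
  rw [mem_exchange]
  grind

theorem adj_exchange {J : P.Vertex} {h : Fin n} (hh : h ∉ J.1) : P.grid.Adj J (exchange J h) := by
  obtain ⟨x, hx, hxh⟩ := J.2.exists_mem (P.blockOf h)
  have hne : h ≠ x := by rintro rfl; exact hh hx
  have : symmDiff J.1 (exchange J h).1 = {h, x} := by
    ext y
    have := fun hy hxy => J.2.eq_of_mem (x := y) (y := x) hy hx hxy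
    simp only [Finset.mem_symmDiff, mem_exchange, Finset.mem_insert, Finset.mem_singleton]
    grind
  change (symmDiff J.1 (exchange J h).1).card = 2
  rw [this, Finset.card_pair hne]

/-- Every neighbour of `J` in the grid arises from `J` by an exchange. -/
theorem exists_exchange_of_adj {J J' : P.Vertex} (hadj : P.grid.Adj J J') :
    ∃ h ∈ J'.1, J' = exchange J h := by
  have hnot : ¬ J'.1 ⊆ J.1 := fun hsub => P.grid.ne_of_adj hadj <| Subtype.ext
    (Finset.eq_of_subset_of_card_le hsub (by rw [J.2.card_eq, J'.2.card_eq])).symm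
  obtain ⟨h, hh, hhJ⟩ := Finset.not_subset.1 hnot
  refine ⟨h, hh, Subtype.ext ?_⟩
  obtain ⟨x, hx, hxh⟩ := J.2.exists_mem (P.blockOf h)
  have hne : h ≠ x := by rintro rfl; exact hhJ hx
  have hxJ' : x ∉ J'.1 := fun hx' => hne (J'.2.eq_of_mem hh hx' hxh.symm)
  have hsym : {h, x} = symmDiff J.1 J'.1 := by
    refine Finset.eq_of_subset_of_card_le ?_ ?_
    · intro y
      simp only [Finset.mem_symmDiff, Finset.mem_insert, Finset.mem_singleton]
      grind
    · rw [Finset.card_pair hne]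
      exact le_of_eq hadj
  ext y
  have h1 := Finset.ext_iff.1 hsym y
  have := fun hy hxy => J.2.eq_of_mem (x := y) (y := x) hy hx hxy
  simp only [Finset.mem_symmDiff, Finset.mem_insert, Finset.mem_singleton] at h1
  rw [mem_exchange]
  grind

/-! ### Violators -/

open Classical in
/-- The elements `h ∈ S` that violate the vertex `J`: the edge from `J` to the vertex that
contains `h` in place of an element of `J` leaves `J`. -/
noncomputable def violators (ψ : GraphOrientation P.grid) (J : P.Vertex) (S : Finset (Fin n)) :
    Finset (Fin n) :=
  S.filter fun h => ψ.arrow J (exchange J h)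

theorem mem_violators {ψ : GraphOrientation P.grid} {J : P.Vertex} {S : Finset (Fin n)}
    {h : Fin n} : h ∈ violators ψ J S ↔ h ∈ S ∧ ψ.arrow J (exchange J h) := by
  simp [violators]

theorem violators_eq_empty_iff {ψ : GraphOrientation P.grid} {J : P.Vertex}
    {S : Finset (Fin n)} : violators ψ J S = ∅ ↔ ∀ h ∈ S, ¬ ψ.arrow J (exchange J h) := by
  simp [Finset.eq_empty_iff_forall_notMem, mem_violators]

theorem notMem_of_mem_violators {ψ : GraphOrientation P.grid} {J : P.Vertex}
    {S : Finset (Fin n)} {h : Fin n} (hh : h ∈ violators ψ J S) : h ∉ J.1 := by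
  intro hJ
  have h2 := (mem_violators.1 hh).2
  rw [exchange_of_mem hJ] at h2
  exact P.grid.irrefl (ψ.adj_of_arrow _ _ h2)

theorem isSinkOf_iff {ψ : GraphOrientation P.grid} {J : P.Vertex} {S : Finset (Fin n)}
    (hJ : J.1 ⊆ S) : ψ.IsSinkOf (P.subgridVertices S) J ↔ violators ψ J S = ∅ := by
  constructor
  · rintro ⟨-, h⟩
    refine violators_eq_empty_iff.2 fun x hx => h _ ?_
    intro y hy
    rcases mem_exchange.1 hy with rfl | hy
    exacts [hx, hJ hy.1]
  · refine fun h => ⟨hJ, fun u hu harrow => ?_⟩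
    obtain ⟨x, hx, rfl⟩ := exists_exchange_of_adj (ψ.adj_of_arrow _ _ harrow)
    exact violators_eq_empty_iff.1 h _ (hu hx) harrow

theorem isSinkOf_mono {ψ : GraphOrientation P.grid} {J : P.Vertex} {S Q : Finset (Fin n)}
    (hJ : J.1 ⊆ Q) (hQ : Q ⊆ S) (h : ψ.IsSinkOf (P.subgridVertices S) J) :
    ψ.IsSinkOf (P.subgridVertices Q) J :=
  ⟨hJ, fun u hu => h.2 u (Finset.Subset.trans hu hQ)⟩

theorem isSinkOf_unique {ψ : GraphOrientation P.grid} (hψ : IsUSO ψ) {J J' : P.Vertex}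
    {S : Finset (Fin n)} (h : ψ.IsSinkOf (P.subgridVertices S) J)
    (h' : ψ.IsSinkOf (P.subgridVertices S) J') : J = J' :=
  (hψ S ⟨J, h.1⟩).unique h h'

/-- Locality: if the sink `J` of a subgrid is violated in `S`, then it is violated by an element
of the sink of `S`. -/
theorem exists_mem_violators {ψ : GraphOrientation P.grid} (hψ : IsUSO ψ) {J B : P.Vertex}
    {Q S : Finset (Fin n)} (hQS : Q ⊆ S) (hJ : ψ.IsSinkOf (P.subgridVertices Q) J)
    (hB : ψ.IsSinkOf (P.subgridVertices S) B) (hne : violators ψ J S ≠ ∅) :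
    ∃ h ∈ violators ψ J S, h ∈ B.1 := by
  by_contra! hcon
  have hJQ : J.1 ⊆ Q := hJ.1
  have hBS : B.1 ⊆ S := hB.1
  have h1 : ψ.IsSinkOf (P.subgridVertices (Q ∪ B.1)) J := by
    rw [isSinkOf_iff (hJQ.trans Finset.subset_union_left)]
    refine violators_eq_empty_iff.2 fun x hx harrow => ?_
    rcases Finset.mem_union.1 hx with hx | hx
    · exact violators_eq_empty_iff.1 ((isSinkOf_iff hJQ).1 hJ) _ hx harrow
    · exact hcon x (mem_violators.2 ⟨hBS hx, harrow⟩) hx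
  have h2 := isSinkOf_mono Finset.subset_union_right (Finset.union_subset hQS hBS) hB
  obtain rfl := isSinkOf_unique hψ h1 h2
  exact hne ((isSinkOf_iff hBS).1 hB)

theorem notMem_violators_of_isSinkOf {ψ : GraphOrientation P.grid} {J : P.Vertex}
    {Q S : Finset (Fin n)} (hJ : ψ.IsSinkOf (P.subgridVertices Q) J) {h : Fin n} (hh : h ∈ Q) :
    h ∉ violators ψ J S := fun h' =>
  violators_eq_empty_iff.1 ((isSinkOf_iff hJ.1).1 hJ) _ hh (mem_violators.1 h').2

/-! ### Sampling -/

/-- The sampling lemma, in counted form: `sol Q` is the sink of the subgrid spanned by `Q`, and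
`R` runs through the `r`-element subsets of `S`. An element `h` outside `R` that violates the sink
of `G ∪ R` is one of the `δ` elements of the sink of `G ∪ R ∪ {h}`; so each set `R ∪ {h}` of size
`r + 1` is counted at most `δ` times. -/
theorem sum_card_violators_le {ψ : GraphOrientation P.grid} (hψ : IsUSO ψ) {J₀ : P.Vertex}
    {sol : Finset (Fin n) → P.Vertex}
    (hsol : ∀ Q, J₀.1 ⊆ Q → ψ.IsSinkOf (P.subgridVertices Q) (sol Q))
    {G : Finset (Fin n)} (hG : J₀.1 ⊆ G) (S : Finset (Fin n)) (r : ℕ) :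
    ∑ R ∈ S.powersetCard r, (violators ψ (sol (G ∪ R)) S).card ≤ δ * S.card.choose (r + 1) := by
  have hR : ∀ R, J₀.1 ⊆ G ∪ R := fun R => hG.trans Finset.subset_union_left
  calc
    _ = ((S.powersetCard r).sigma fun R => violators ψ (sol (G ∪ R)) S).card := by
      rw [Finset.card_sigma]
    _ ≤ ((S.powersetCard (r + 1)).sigma fun Q => (sol (G ∪ Q)).1).card := by
      refine Finset.card_le_card_of_injOn (fun x => ⟨insert x.2 x.1, x.2⟩) ?_ ?_
      · rintro ⟨R, h⟩ hx
        obtain ⟨hRS, hh⟩ := Finset.mem_sigma.1 hx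
        rw [Finset.mem_powersetCard] at hRS
        dsimp only at hh
        have hnot : h ∉ G ∪ R := fun h' => notMem_violators_of_isSinkOf (hsol _ (hR R)) h' hh
        have hhS : h ∈ S := (mem_violators.1 hh).1
        refine Finset.mem_sigma.2 ⟨Finset.mem_powersetCard.2
          ⟨Finset.insert_subset hhS hRS.1, ?_⟩, ?_⟩
        · rw [Finset.card_insert_of_notMem (fun h' => hnot (Finset.mem_union_right _ h')), hRS.2]
        · dsimp only
          by_contra hcon
          have hs := hsol _ (hR (insert h R))
          have hsub : (sol (G ∪ insert h R)).1 ⊆ G ∪ R := by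
            intro y hy
            have := hs.1 hy
            rw [Finset.union_insert, Finset.mem_insert] at this
            rcases this with rfl | h'
            exacts [absurd hy hcon, h']
          have heq := isSinkOf_unique hψ (hsol _ (hR R)) (isSinkOf_mono hsub
            (Finset.union_subset_union_right (Finset.subset_insert h R)) hs)
          rw [heq] at hh
          exact notMem_violators_of_isSinkOf hs (by simp) hh
      · rintro ⟨R, h⟩ hx ⟨R', h'⟩ hx' heq
        obtain ⟨-, hh⟩ := Finset.mem_sigma.1 hx
        obtain ⟨-, hh'⟩ := Finset.mem_sigma.1 hx'
        simp only [Sigma.mk.injEq, heq_eq_eq] at heq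
        obtain ⟨h1, rfl⟩ := heq
        have hn : h ∉ R := fun hm => notMem_violators_of_isSinkOf (hsol _ (hR R))
          (Finset.mem_union_right _ hm) hh
        have hn' : h ∉ R' := fun hm => notMem_violators_of_isSinkOf (hsol _ (hR R'))
          (Finset.mem_union_right _ hm) hh'
        have : R = R' := by rw [← Finset.erase_insert hn, h1, Finset.erase_insert hn']
        subst this
        rfl
    _ = δ * S.card.choose (r + 1) := by
      rw [Finset.card_sigma, Finset.sum_congr rfl fun Q _ => (sol (G ∪ Q)).2.card_eq]
      simp [mul_comm]

/-! ### Finding violators, and brute force -/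

/-- Evaluate the edges from `J` to its exchange with each `h` in a list, skipping those `h` that
lie in `J`, and continue with an algorithm that depends on the set of violators found. -/
def askViolators (J : P.Vertex) :
    List (Fin n) → (Finset (Fin n) → EdgeAlgorithm P.grid) → EdgeAlgorithm P.grid
  | [], k => k ∅
  | h :: l, k =>
    if hh : h ∈ J.1 then askViolators J l k
    else evaluate ⟨(J, exchange J h), adj_exchange hh⟩ fun b =>
      askViolators J l fun V => k (if b then insert h V else V)

theorem violators_insert (ψ : GraphOrientation P.grid) (J : P.Vertex) (h : Fin n)
    (S : Finset (Fin n)) (b : Bool) (hb : b = true ↔ ψ.arrow J (exchange J h)) :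
    violators ψ J (insert h S) =
      if b then insert h (violators ψ J S) else violators ψ J S := by
  ext x
  split_ifs with hif <;> simp only [mem_violators, Finset.mem_insert] <;> grind

theorem violators_insert_of_mem (ψ : GraphOrientation P.grid) {J : P.Vertex} {h : Fin n}
    (S : Finset (Fin n)) (hh : h ∈ J.1) :
    violators ψ J (insert h S) = violators ψ J S := by
  refine violators_insert ψ J h S false ?_
  simp only [Bool.false_eq_true, false_iff]
  exact fun h' => notMem_of_mem_violators
    (mem_violators.2 ⟨Finset.mem_singleton_self h, h'⟩) hh

theorem returns_askViolators {ψ : GraphOrientation P.grid} {v J : P.Vertex} :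
    ∀ {l : List (Fin n)} {k : Finset (Fin n) → EdgeAlgorithm P.grid},
      (k (violators ψ J l.toFinset)).Returns ψ v → (askViolators J l k).Returns ψ v
  | [], k, h => h
  | x :: l, k, h => by
    rw [List.toFinset_cons] at h
    unfold GridPartition.askViolators
    split_ifs with hx
    · rw [violators_insert_of_mem ψ _ hx] at h
      exact returns_askViolators h
    · refine returns_askViolators (l := l) ?_
      rwa [← violators_insert]
      simp [GraphOrientation.evalEdge]

theorem expectedEvaluations_askViolators_le (ψ : GraphOrientation P.grid) (J : P.Vertex) :
    ∀ (l : List (Fin n)) (k : Finset (Fin n) → EdgeAlgorithm P.grid),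
      (askViolators J l k).expectedEvaluations ψ ≤
        l.length + (k (violators ψ J l.toFinset)).expectedEvaluations ψ
  | [], k => by simp [askViolators, violators]
  | x :: l, k => by
    rw [List.toFinset_cons, List.length_cons]
    unfold askViolators
    push_cast
    split_ifs with hx
    · rw [violators_insert_of_mem ψ _ hx]
      linarith [expectedEvaluations_askViolators_le ψ J l k]
    · have := expectedEvaluations_askViolators_le ψ J l fun V =>
        k (if ψ.evalEdge ⟨(J, exchange J x), adj_exchange hx⟩ then insert x V else V)
      rw [← violators_insert ψ J x _ _ (by simp [GraphOrientation.evalEdge])] at this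
      simp only [expectedEvaluations]
      linarith

/-- Evaluate all edges of the subgrid spanned by `S` at each vertex of a list in turn, until a
sink of this subgrid is found. If there is none in the list, return `J₀`. -/
noncomputable def firstSink (J₀ : P.Vertex) (S : Finset (Fin n)) :
    List P.Vertex → EdgeAlgorithm P.grid
  | [] => output J₀
  | J :: l => askViolators J S.toList fun V => if V = ∅ then output J else firstSink J₀ S l

theorem returns_firstSink {ψ : GraphOrientation P.grid} (hψ : IsUSO ψ) {J₀ v : P.Vertex}
    {S : Finset (Fin n)} (hv : ψ.IsSinkOf (P.subgridVertices S) v) :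
    ∀ {l : List P.Vertex}, v ∈ l → (∀ J ∈ l, J.1 ⊆ S) → (firstSink J₀ S l).Returns ψ v
  | J :: l, hmem, hl => by
    refine returns_askViolators ?_
    rw [Finset.toList_toFinset]
    have hJ := hl J (by simp)
    split_ifs with h
    · exact isSinkOf_unique hψ ((isSinkOf_iff hJ).2 h) hv
    · rcases List.mem_cons.1 hmem with rfl | hmem
      · exact absurd ((isSinkOf_iff hJ).1 hv) h
      · exact returns_firstSink hψ hv hmem fun J' hJ' => hl J' (by simp [hJ'])

theorem expectedEvaluations_firstSink_le (ψ : GraphOrientation P.grid) (J₀ : P.Vertex)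
    (S : Finset (Fin n)) :
    ∀ l : List P.Vertex,
      (firstSink J₀ S l).expectedEvaluations ψ ≤ (l.length : ℝ) * (S.card : ℝ)
  | [] => by simp [firstSink, expectedEvaluations]
  | J :: l => by
    refine (expectedEvaluations_askViolators_le ψ J _ _).trans ?_
    rw [Finset.toList_toFinset, Finset.length_toList, List.length_cons]
    push_cast
    split_ifs with h
    · simp only [expectedEvaluations]
      nlinarith [Nat.cast_nonneg (α := ℝ) l.length, Nat.cast_nonneg (α := ℝ) S.card]
    · linarith [expectedEvaluations_firstSink_le ψ J₀ S l]

open Classical in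
/-- The vertices of the subgrid spanned by `S`, as a finite set. -/
noncomputable def subgridFinset (P : GridPartition n δ) (S : Finset (Fin n)) : Finset P.Vertex :=
  Finset.univ.filter fun J => J.1 ⊆ S

theorem mem_subgridFinset {S : Finset (Fin n)} {J : P.Vertex} :
    J ∈ P.subgridFinset S ↔ J.1 ⊆ S := by
  simp [subgridFinset]

theorem card_subgridFinset_le (S : Finset (Fin n)) : (P.subgridFinset S).card ≤ S.card ^ δ := by
  refine le_trans ?_ (Nat.choose_le_pow S.card δ)
  rw [← Finset.card_powersetCard]
  exact Finset.card_le_card_of_injOn Subtype.val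
    (fun J hJ => Finset.mem_powersetCard.2 ⟨mem_subgridFinset.1 hJ, J.2.card_eq⟩)
    Subtype.val_injective.injOn

/-- Find the sink of the subgrid spanned by `S` by trying all its vertices. -/
noncomputable def bruteForce (J₀ : P.Vertex) (S : Finset (Fin n)) : EdgeAlgorithm P.grid :=
  firstSink J₀ S (P.subgridFinset S).toList

theorem returns_bruteForce {ψ : GraphOrientation P.grid} (hψ : IsUSO ψ) {J₀ v : P.Vertex}
    {S : Finset (Fin n)} (hv : ψ.IsSinkOf (P.subgridVertices S) v) :
    (bruteForce J₀ S).Returns ψ v :=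
  returns_firstSink hψ hv (Finset.mem_toList.2 (mem_subgridFinset.2 hv.1))
    fun _ hJ => mem_subgridFinset.1 (Finset.mem_toList.1 hJ)

theorem expectedEvaluations_bruteForce_le (ψ : GraphOrientation P.grid) (J₀ : P.Vertex)
    (S : Finset (Fin n)) :
    (bruteForce J₀ S).expectedEvaluations ψ ≤ (S.card : ℝ) ^ (δ + 1) := by
  refine (expectedEvaluations_firstSink_le ψ J₀ S _).trans ?_
  rw [Finset.length_toList, pow_succ]
  have : ((P.subgridFinset S).card : ℝ) ≤ (S.card : ℝ) ^ δ := by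
    exact_mod_cast card_subgridFinset_le S
  gcongr

/-! ### Clarkson's sampling scheme -/

/-- At most `j` rounds of Clarkson's sampling scheme on the subgrid spanned by `S`, given a
procedure `sub` for smaller subgrids. A round solves the subgrid spanned by `G` and a random
`r`-element subset of `S`; the violators of the sink obtained are added to `G`, however many
they are. If no round ends without violators, `J₀` is returned. -/
noncomputable def samplingRounds (sub : Finset (Fin n) → EdgeAlgorithm P.grid) (J₀ : P.Vertex)
    (S : Finset (Fin n)) (r : ℕ) (hr : r ≤ S.card) :
    ℕ → Finset (Fin n) → EdgeAlgorithm P.grid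
  | 0, _ => output J₀
  | j + 1, G => sample (S.powersetCard r) (Finset.powersetCard_nonempty.2 hr) fun R =>
      (sub (G ∪ R)).bind fun J => askViolators J S.toList fun V =>
        if V = ∅ then output J else samplingRounds sub J₀ S r hr j (G ∪ V)

section samplingRounds

variable {ψ : GraphOrientation P.grid} {J₀ : P.Vertex} {sol : Finset (Fin n) → P.Vertex}
  {sub : Finset (Fin n) → EdgeAlgorithm P.grid} {S : Finset (Fin n)} {r : ℕ}

/-- Each round that finds violators adds an element of the sink of `S` to `G`, so `δ + 1` rounds
suffice. -/
theorem returns_samplingRounds (hψ : IsUSO ψ)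
    (hsol : ∀ Q, J₀.1 ⊆ Q → ψ.IsSinkOf (P.subgridVertices Q) (sol Q))
    (hsub : ∀ Q, J₀.1 ⊆ Q → Q ⊆ S → (sub Q).Returns ψ (sol Q)) (hr : r ≤ S.card) :
    ∀ (j : ℕ) (G : Finset (Fin n)), J₀.1 ⊆ G → G ⊆ S → δ < j + ((sol S).1 ∩ G).card →
      (samplingRounds sub J₀ S r hr j G).Returns ψ (sol S)
  | 0, G, _, _, hj => by
    have := Finset.card_le_card (Finset.inter_subset_left (s₁ := (sol S).1) (s₂ := G))
    rw [(sol S).2.card_eq] at this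
    omega
  | j + 1, G, hG, hGS, hj => by
    refine returns_sample _ fun R hR => ?_
    have hRS := (Finset.mem_powersetCard.1 hR).1
    have hQ : J₀.1 ⊆ G ∪ R := hG.trans Finset.subset_union_left
    have hQS : G ∪ R ⊆ S := Finset.union_subset hGS hRS
    refine Returns.bind ?_ (hsub _ hQ hQS)
    refine returns_askViolators ?_
    rw [Finset.toList_toFinset]
    have hs := hsol _ hQ
    have hB := hsol S (hG.trans hGS)
    split_ifs with hV
    · have hsQ : (sol (G ∪ R)).1 ⊆ G ∪ R := hs.1
      exact isSinkOf_unique hψ ((isSinkOf_iff (hsQ.trans hQS)).2 hV) hB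
    · have hVS : violators ψ (sol (G ∪ R)) S ⊆ S := fun x hx => (mem_violators.1 hx).1
      refine returns_samplingRounds hψ hsol hsub hr j _ (hG.trans Finset.subset_union_left)
        (Finset.union_subset hGS hVS) ?_
      obtain ⟨h, hh, hhB⟩ := exists_mem_violators hψ hQS hs hB hV
      have hhG : h ∉ G := fun h' => notMem_violators_of_isSinkOf hs
        (Finset.mem_union_left _ h') hh
      have : ((sol S).1 ∩ G).card <
          ((sol S).1 ∩ (G ∪ violators ψ (sol (G ∪ R)) S)).card := by
        refine Finset.card_lt_card ⟨Finset.inter_subset_inter_left Finset.subset_union_left, ?_⟩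
        intro hsub'
        have := hsub' (Finset.mem_inter.2 ⟨hhB, Finset.mem_union_right _ hh⟩)
        exact hhG (Finset.mem_inter.1 this).2
      omega

/-- The expected number of violators of the sink of `G ∪ R`, for a random `r`-element set `R`. -/
theorem average_card_violators_le (hψ : IsUSO ψ)
    (hsol : ∀ Q, J₀.1 ⊆ Q → ψ.IsSinkOf (P.subgridVertices Q) (sol Q))
    {G : Finset (Fin n)} (hG : J₀.1 ⊆ G) (hr : r ≤ S.card) :
    (∑ R ∈ S.powersetCard r, ((violators ψ (sol (G ∪ R)) S).card : ℝ)) /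
      ((S.powersetCard r).card : ℝ) ≤ δ * S.card / (r + 1) := by
  have h1 : (∑ R ∈ S.powersetCard r, ((violators ψ (sol (G ∪ R)) S).card : ℝ)) ≤
      δ * (S.card.choose (r + 1) : ℝ) := by
    exact_mod_cast sum_card_violators_le hψ hsol hG S r
  have h2 : (S.card.choose (r + 1) : ℝ) * (r + 1) ≤ S.card.choose r * S.card := by
    have := Nat.choose_succ_right_eq S.card r
    have h3 : S.card.choose (r + 1) * (r + 1) ≤ S.card.choose r * S.card := by
      rw [this]
      exact Nat.mul_le_mul_left _ (Nat.sub_le _ _)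
    exact_mod_cast h3
  have hpos : (0 : ℝ) < S.card.choose r := by exact_mod_cast Nat.choose_pos hr
  rw [Finset.card_powersetCard, div_le_div_iff₀ hpos (by positivity)]
  calc
    _ ≤ (δ * (S.card.choose (r + 1) : ℝ)) * (r + 1) := by gcongr
    _ = δ * ((S.card.choose (r + 1) : ℝ) * (r + 1)) := by ring
    _ ≤ δ * (S.card.choose r * S.card) := by gcongr
    _ = _ := by ring

/-- An affine bound for the cost of the subproblems turns the random size of `G` into its
expectation. -/
theorem expectedEvaluations_samplingRounds_le (hψ : IsUSO ψ)
    (hsol : ∀ Q, J₀.1 ⊆ Q → ψ.IsSinkOf (P.subgridVertices Q) (sol Q))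
    (hsub : ∀ Q, J₀.1 ⊆ Q → Q ⊆ S → (sub Q).Returns ψ (sol Q)) {α β : ℝ} (hα : 0 ≤ α)
    (hβ : 0 ≤ β)
    (hcost : ∀ Q, J₀.1 ⊆ Q → Q ⊆ S → (sub Q).expectedEvaluations ψ ≤ α * Q.card + β)
    (hr : r ≤ S.card) :
    ∀ (j : ℕ) (G : Finset (Fin n)), J₀.1 ⊆ G → G ⊆ S →
      (samplingRounds sub J₀ S r hr j G).expectedEvaluations ψ ≤
        j * (S.card + α * (G.card + r + j * (δ * S.card / (r + 1))) + β)
  | 0, G, _, _ => by simp [samplingRounds, expectedEvaluations]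
  | j + 1, G, hG, hGS => by
    have hE : (0 : ℝ) ≤ δ * S.card / (r + 1) := by positivity
    have havg := average_card_violators_le hψ hsol hG hr
    set E : ℝ := δ * S.card / (r + 1) with hEdef
    have hpos : (0 : ℝ) < (S.powersetCard r).card := by
      exact_mod_cast (Finset.powersetCard_nonempty.2 hr).card_pos
    unfold samplingRounds
    rw [expectedEvaluations_sample]
    have key : ∀ R ∈ S.powersetCard r,
        ((sub (G ∪ R)).bind fun J => askViolators J S.toList fun V =>
          if V = ∅ then output J else
            samplingRounds sub J₀ S r hr j (G ∪ V)).expectedEvaluations ψ ≤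
        (j + 1) * (S.card + α * (G.card + r) + β) + j * α * (j * E) +
          (violators ψ (sol (G ∪ R)) S).card * (j * α) := by
      intro R hR
      obtain ⟨hRS, hRr⟩ := Finset.mem_powersetCard.1 hR
      have hQ : J₀.1 ⊆ G ∪ R := hG.trans Finset.subset_union_left
      have hQS : G ∪ R ⊆ S := Finset.union_subset hGS hRS
      rw [expectedEvaluations_bind _ (hsub _ hQ hQS)]
      have h1 := expectedEvaluations_askViolators_le ψ (sol (G ∪ R)) S.toList fun V =>
        if V = ∅ then output (sol (G ∪ R)) else samplingRounds sub J₀ S r hr j (G ∪ V)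
      rw [Finset.toList_toFinset, Finset.length_toList] at h1
      have h2 := hcost _ hQ hQS
      have h3 : ((G ∪ R).card : ℝ) ≤ G.card + r := by
        rw [← hRr]
        exact_mod_cast Finset.card_union_le G R
      have h4 := mul_le_mul_of_nonneg_left h3 hα
      have h5 : (if violators ψ (sol (G ∪ R)) S = ∅ then output (sol (G ∪ R)) else
          samplingRounds sub J₀ S r hr j
            (G ∪ violators ψ (sol (G ∪ R)) S)).expectedEvaluations ψ ≤
          j * (S.card + α * (G.card + (violators ψ (sol (G ∪ R)) S).card + r + j * E) + β) := by
        split_ifs with hV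
        · simp only [expectedEvaluations]
          positivity
        · have hVS : violators ψ (sol (G ∪ R)) S ⊆ S := fun x hx => (mem_violators.1 hx).1
          refine (expectedEvaluations_samplingRounds_le hψ hsol hsub hα hβ hcost hr j _
            (hG.trans Finset.subset_union_left) (Finset.union_subset hGS hVS)).trans ?_
          have h6 : ((G ∪ violators ψ (sol (G ∪ R)) S).card : ℝ) ≤
              G.card + (violators ψ (sol (G ∪ R)) S).card := by
            exact_mod_cast Finset.card_union_le _ _
          gcongr
      linarith
    refine (div_le_div_of_nonneg_right (Finset.sum_le_sum key) hpos.le).trans ?_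
    rw [Finset.sum_add_distrib, ← Finset.sum_mul, add_div, Finset.sum_const, nsmul_eq_mul,
      mul_div_cancel_left₀ _ hpos.ne', mul_div_right_comm]
    have h6 := mul_le_mul_of_nonneg_right havg (by positivity : 0 ≤ (j : ℝ) * α)
    push_cast
    nlinarith [mul_nonneg (mul_nonneg (Nat.cast_nonneg (α := ℝ) j) hα) hE, mul_nonneg hα hE]

end samplingRounds

/-! ### The recursive algorithm and its cost -/

theorem le_sqrt_of_threshold_le {D m : ℕ} (h : 256 * D ^ 6 ≤ m) :
    16 * (D : ℝ) ^ 3 ≤ √(m : ℝ) := by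
  refine Real.le_sqrt_of_sq_le ?_
  have : (256 * (D : ℝ) ^ 6) ≤ m := by exact_mod_cast h
  nlinarith

theorem sampleSize_le {D m : ℕ} (hD : 0 < D) (h : 256 * D ^ 6 ≤ m) :
    D * (m.sqrt + 1) ≤ m := by
  have h1 : 16 * D ^ 3 ≤ m.sqrt := Nat.le_sqrt'.2 (by calc
    (16 * D ^ 3) ^ 2 = 256 * D ^ 6 := by ring
    _ ≤ m := h)
  have h2 : m.sqrt * m.sqrt ≤ m := Nat.sqrt_le m
  have h3 : D ≤ D ^ 3 := Nat.le_self_pow (by norm_num) D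
  nlinarith

/-- The recursive algorithm for the subgrid spanned by `S`, with recursion depth at most `k`:
subgrids with few elements, and all those at depth `k`, are solved by brute force. With
`D = δ + 1`, the sample size is about `D√|S|`, so that the sample and the violators of all rounds
are balanced; from the threshold `256 D⁶` on, a level of the recursion halves the coefficient of
`√|S|` in the cost. The vertex `J₀` is contained in every set that is considered, so that all
subgrids are nonempty. -/
noncomputable def solve (J₀ : P.Vertex) : ℕ → Finset (Fin n) → EdgeAlgorithm P.grid
  | 0, S => bruteForce J₀ S
  | k + 1, S =>
    if h : 256 * (δ + 1) ^ 6 ≤ S.card then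
      samplingRounds (solve J₀ k) J₀ S ((δ + 1) * (S.card.sqrt + 1))
        (sampleSize_le δ.succ_pos h) (δ + 1) J₀.1
    else bruteForce J₀ S

theorem returns_solve {ψ : GraphOrientation P.grid} (hψ : IsUSO ψ) {J₀ : P.Vertex}
    {sol : Finset (Fin n) → P.Vertex}
    (hsol : ∀ Q, J₀.1 ⊆ Q → ψ.IsSinkOf (P.subgridVertices Q) (sol Q)) :
    ∀ (k : ℕ) (S : Finset (Fin n)), J₀.1 ⊆ S → (solve J₀ k S).Returns ψ (sol S)
  | 0, S, hS => returns_bruteForce hψ (hsol S hS)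
  | k + 1, S, hS => by
    unfold solve
    split_ifs with h
    · exact returns_samplingRounds hψ hsol (fun Q hQ _ => returns_solve hψ hsol k Q hQ) _ _ _
        subset_rfl hS (by omega)
    · exact returns_bruteForce hψ (hsol S hS)

/-- The arithmetic of one level of the recursion. Here `d = δ`, `m = |S|`, `r` is the sample size
and `E` bounds the expected number of violators. The subproblems have expected size at most
`s² = 4D√m`, and the slope `2D + b / (2s)` and the constant `b s / 2` are those of the tangent at
`s²` of the cost bound `q ↦ 2D q + b √q`. -/
theorem rounds_cost_le {D m d s E : ℝ} {r : ℕ} {b : ℝ} (hD : D = d + 1) (hd : 0 ≤ d) (hb : 0 ≤ b)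
    (hm : 0 ≤ m) (hx : 16 * D ^ 3 ≤ √m) (hr : D * √m ≤ r) (hr' : (r : ℝ) ≤ D * (√m + 1))
    (hs : s = √(4 * D * √m)) (hE : E = d * m / (r + 1)) :
    D * (m + (2 * D + b / (2 * s)) * (d + r + D * E) + b * s / 2) ≤ 2 * D * m + b / 2 * √m := by
  have hD1 : 1 ≤ D := by linarith
  have hD3 : D ^ 2 ≤ D ^ 3 := pow_le_pow_right₀ hD1 (by norm_num)
  have hD2 : 1 ≤ D ^ 2 := one_le_pow₀ hD1
  have hmx : m = √m * √m := (Real.mul_self_sqrt hm).symm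
  set x := √m
  have hx1 : 1 ≤ x := by linarith
  have hss : s * s = 4 * D * x := by
    rw [hs]
    exact Real.mul_self_sqrt (by positivity)
  have hs0 : 0 < s := by
    rw [hs]
    positivity
  have hEx : D * E ≤ d * x := by
    rw [hE, hmx, mul_div_assoc', div_le_iff₀ (by positivity)]
    nlinarith [mul_le_mul_of_nonneg_left hr (by positivity : 0 ≤ d * x)]
  have hsize : d + r + D * E ≤ s * s := by
    rw [hss]
    nlinarith
  have h1 : (2 * D + b / (2 * s)) * (d + r + D * E) ≤ 2 * D * (4 * D * x) + b * s / 2 := by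
    calc
      _ ≤ (2 * D + b / (2 * s)) * (s * s) := by gcongr
      _ = 2 * D * (s * s) + b * s / 2 := by field_simp
      _ = _ := by rw [hss]
  have h2 : 2 * D * s ≤ x := by
    refine abs_le_of_sq_le_sq' ?_ (by linarith) |>.2
    calc
      (2 * D * s) ^ 2 = 4 * D ^ 2 * (s * s) := by ring
      _ = 16 * D ^ 3 * x := by rw [hss]; ring
      _ ≤ x * x := by gcongr
      _ = x ^ 2 := by ring
  have h3 : 8 * D ^ 2 * x ≤ m := by
    rw [hmx]
    gcongr
    linarith
  calc
    _ ≤ D * (m + (2 * D * (4 * D * x) + b * s / 2) + b * s / 2) := by gcongr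
    _ = D * m + D * (8 * D ^ 2 * x) + b / 2 * (2 * D * s) := by ring
    _ ≤ D * m + D * m + b / 2 * x := by gcongr
    _ = _ := by ring

theorem le_mul_sqrt_natCast (m : ℕ) {b : ℝ} (hb : 0 ≤ b) (k : ℕ) (h : (m : ℝ) ^ (k + 1) ≤ b) :
    (m : ℝ) ^ (k + 1) ≤ b * √(m : ℝ) := by
  rcases Nat.eq_zero_or_pos m with rfl | hm
  · simp
  · have : 1 ≤ √(m : ℝ) := Real.one_le_sqrt.2 (by exact_mod_cast hm)
    nlinarith

/-- The bound is concave in the size of `S`. Each level of the recursion halves the contribution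
of the instances at which the recursion is cut off. -/
theorem expectedEvaluations_solve_le {ψ : GraphOrientation P.grid} (hψ : IsUSO ψ) {J₀ : P.Vertex}
    {sol : Finset (Fin n) → P.Vertex}
    (hsol : ∀ Q, J₀.1 ⊆ Q → ψ.IsSinkOf (P.subgridVertices Q) (sol Q)) :
    ∀ (k : ℕ) (S : Finset (Fin n)), J₀.1 ⊆ S → (solve J₀ k S).expectedEvaluations ψ ≤
      2 * ((δ : ℝ) + 1) * S.card +
        ((256 * ((δ : ℝ) + 1) ^ 6) ^ (δ + 1) + (n : ℝ) ^ (δ + 1) / 2 ^ k) * √(S.card : ℝ)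
  | 0, S, hS => by
    refine (expectedEvaluations_bruteForce_le ψ J₀ S).trans ?_
    have hn : (S.card : ℝ) ≤ n := by exact_mod_cast card_finset_fin_le S
    have h0 : (0 : ℝ) ≤ 2 * ((δ : ℝ) + 1) * S.card := by positivity
    refine (le_mul_sqrt_natCast S.card (by positivity) δ ?_).trans (le_add_of_nonneg_left h0)
    have h1 : (S.card : ℝ) ^ (δ + 1) ≤ (n : ℝ) ^ (δ + 1) := by gcongr
    have h2 : (0 : ℝ) ≤ (256 * ((δ : ℝ) + 1) ^ 6) ^ (δ + 1) := by positivity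
    rw [pow_zero, div_one]
    linarith
  | k + 1, S, hS => by
    unfold solve
    set B : ℝ := (256 * ((δ : ℝ) + 1) ^ 6) ^ (δ + 1) with hB
    set b : ℝ := B + (n : ℝ) ^ (δ + 1) / 2 ^ k with hb
    have hB0 : 0 ≤ B := by positivity
    have hM0 : 0 ≤ (n : ℝ) ^ (δ + 1) / 2 ^ k := by positivity
    have hb0 : 0 ≤ b := by positivity
    have hhalf : b / 2 ≤ B + (n : ℝ) ^ (δ + 1) / 2 ^ (k + 1) := by
      rw [pow_succ (2 : ℝ), ← div_div]
      linarith
    split_ifs with h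
    · have hx := le_sqrt_of_threshold_le h
      push_cast at hx
      set m := S.card
      set s : ℝ := √(4 * ((δ : ℝ) + 1) * √(m : ℝ)) with hs
      have hx0 : 0 < √(m : ℝ) := lt_of_lt_of_le (by positivity) hx
      have hs0 : 0 < s := by positivity
      have hcost : ∀ Q, J₀.1 ⊆ Q → Q ⊆ S → (solve J₀ k Q).expectedEvaluations ψ ≤
          (2 * ((δ : ℝ) + 1) + b / (2 * s)) * Q.card + b * s / 2 := by
        intro Q hQ _
        refine (expectedEvaluations_solve_le hψ hsol k Q hQ).trans ?_
        -- the square root lies below its tangent at `s²`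
        have hq : √(Q.card : ℝ) ≤ Q.card / (2 * s) + s / 2 := by
          have h1 := Real.mul_self_sqrt (Nat.cast_nonneg (α := ℝ) Q.card)
          rw [← sub_nonneg]
          have : (Q.card : ℝ) / (2 * s) + s / 2 - √(Q.card : ℝ) =
              (√(Q.card : ℝ) - s) ^ 2 / (2 * s) := by
            rw [sub_sq, sq, h1]
            field_simp
            ring
          rw [this]
          positivity
        calc
          _ ≤ 2 * ((δ : ℝ) + 1) * Q.card + b * (Q.card / (2 * s) + s / 2) := by gcongr
          _ = _ := by ring
      have hloop := expectedEvaluations_samplingRounds_le hψ hsol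
        (fun Q hQ _ => returns_solve hψ hsol k Q hQ) (by positivity) (by positivity) hcost
        (sampleSize_le δ.succ_pos h) (δ + 1) J₀.1 subset_rfl hS
      refine hloop.trans ?_
      rw [J₀.2.card_eq]
      push_cast
      have hsqrt : √(m : ℝ) ≤ m.sqrt + 1 := Real.real_sqrt_le_nat_sqrt_succ
      have hsqrt' : (m.sqrt : ℝ) ≤ √(m : ℝ) := Real.nat_sqrt_le_real_sqrt
      have := rounds_cost_le (D := (δ : ℝ) + 1) (m := m) (d := δ) (s := s)
        (r := (δ + 1) * (m.sqrt + 1)) rfl (by positivity) hb0 (by positivity) hx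
        (by push_cast; gcongr) (by push_cast; gcongr) hs rfl
      push_cast at this
      refine this.trans ?_
      gcongr
    · refine (expectedEvaluations_bruteForce_le ψ J₀ S).trans ?_
      have h0 : (0 : ℝ) ≤ 2 * ((δ : ℝ) + 1) * S.card := by positivity
      refine (le_mul_sqrt_natCast S.card (by positivity) δ ?_).trans (le_add_of_nonneg_left h0)
      have h1 : (S.card : ℝ) ≤ 256 * ((δ : ℝ) + 1) ^ 6 := by exact_mod_cast (not_le.1 h).le
      have h2 : (S.card : ℝ) ^ (δ + 1) ≤ B := by
        rw [hB]
        gcongr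
      have h3 : (0 : ℝ) ≤ (n : ℝ) ^ (δ + 1) / 2 ^ (k + 1) := by positivity
      linarith

theorem threshold_pow_le {δ : ℕ} (hδ : 1 ≤ δ) :
    (256 * (δ + 1) ^ 6) ^ (δ + 1) ≤ 2 ^ 28 * δ ^ (40 * δ) := by
  rcases hδ.eq_or_lt with rfl | h2
  · norm_num
  · have h1 : 256 * (δ + 1) ^ 6 ≤ δ ^ 20 := by
      calc
        256 * (δ + 1) ^ 6 ≤ 2 ^ 8 * (2 * δ) ^ 6 := by gcongr <;> omega
        _ = 2 ^ 14 * δ ^ 6 := by ring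
        _ ≤ δ ^ 14 * δ ^ 6 := by gcongr; omega
        _ = δ ^ 20 := by ring
    calc
      (256 * (δ + 1) ^ 6) ^ (δ + 1) ≤ (δ ^ 20) ^ (δ + 1) := by gcongr
      _ = δ ^ (20 * (δ + 1)) := by rw [← pow_mul]
      _ ≤ δ ^ (40 * δ) := Nat.pow_le_pow_right (by omega) (by omega)
      _ ≤ _ := Nat.le_mul_of_pos_left _ (by norm_num)

end GridPartition

theorem mainTheorem4 :
    ∃ C c : ℕ, ∀ (n δ : ℕ) (P : GridPartition n δ),
      ∃ A : EdgeAlgorithm P.grid, ∀ ψ : GraphOrientation P.grid, IsUSO ψ →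
        A.FindsSink ψ ∧
        A.expectedEvaluations ψ ≤ (C : ℝ) * ((δ : ℝ) * (n : ℝ) + (δ : ℝ) ^ (c * δ)) := by
  refine ⟨2 ^ 58, 80, fun n δ P => ?_⟩
  obtain ⟨J₀⟩ := P.nonempty_vertex
  -- The depth only has to satisfy `n ^ (δ + 1) ≤ 2 ^ depth`, so that the cutoff costs at most
  -- one further multiple of `√n`.
  refine ⟨GridPartition.solve J₀ (n ^ (δ + 1)) Finset.univ, fun ψ hψ => ?_⟩
  have hex : ∀ Q, J₀.1 ⊆ Q → ∃ J, ψ.IsSinkOf (P.subgridVertices Q) J :=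
    fun Q hQ => (hψ Q ⟨J₀, hQ⟩).exists
  have : Nonempty P.Vertex := ⟨J₀⟩
  choose! sol hsol using hex
  have hJ₀ := Finset.subset_univ J₀.1
  refine ⟨(GridPartition.returns_solve hψ hsol _ _ hJ₀).findsSink ?_, ?_⟩
  · have h := hsol _ hJ₀
    exact ⟨trivial, fun u _ => h.2 u (Finset.subset_univ _)⟩
  refine (GridPartition.expectedEvaluations_solve_le hψ hsol _ _ hJ₀).trans ?_
  rw [Finset.card_univ, Fintype.card_fin]
  rcases Nat.eq_zero_or_pos n with rfl | hn
  · simp only [Nat.cast_zero, Real.sqrt_zero, mul_zero, add_zero]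
    positivity
  have hδ : 1 ≤ δ := Nat.one_le_iff_ne_zero.2 fun h0 => by
    subst h0
    exact (P.blockOf ⟨0, hn⟩).elim0
  have hcut : (n : ℝ) ^ (δ + 1) / 2 ^ (n ^ (δ + 1)) ≤ 1 := by
    rw [div_le_one (by positivity)]
    exact_mod_cast Nat.lt_two_pow_self.le
  have hB : (256 * ((δ : ℝ) + 1) ^ 6) ^ (δ + 1) ≤ 2 ^ 28 * (δ : ℝ) ^ (40 * δ) := by
    exact_mod_cast GridPartition.threshold_pow_le hδ
  have hδ' : (1 : ℝ) ≤ δ := by exact_mod_cast hδ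
  have hE : (1 : ℝ) ≤ (δ : ℝ) ^ (40 * δ) := one_le_pow₀ hδ'
  have hE2 : (δ : ℝ) ^ (80 * δ) = (δ : ℝ) ^ (40 * δ) * (δ : ℝ) ^ (40 * δ) := by
    rw [← pow_add]
    congr 1
    ring
  have hnδ : (n : ℝ) ≤ δ * n := le_mul_of_one_le_left (by positivity) hδ'
  have hsq := Real.mul_self_sqrt (Nat.cast_nonneg (α := ℝ) n)
  push_cast
  rw [hE2]
  set e : ℝ := (δ : ℝ) ^ (40 * δ)
  set y := √(n : ℝ)
  have hb : (256 * ((δ : ℝ) + 1) ^ 6) ^ (δ + 1) + (n : ℝ) ^ (δ + 1) / 2 ^ (n ^ (δ + 1)) ≤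
      2 ^ 29 * e := by linarith
  -- `2 t y ≤ t² + y²`, so that the square root is absorbed by the two terms of the bound
  have hty : 2 ^ 29 * e * y ≤ 2 ^ 57 * (e * e) + n := by
    nlinarith [sq_nonneg (2 ^ 28 * e - y), sq_nonneg y]
  have := mul_le_mul_of_nonneg_right hb (Real.sqrt_nonneg n)
  nlinarith
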